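/- Let $X$ be a Polish space, $Y$ a Polish space with a complete distance $d_Y$ metrizing its topology, and $m$ a finite non-negative Borel measure on $X$. Let $L^0(X,Y;m)$ be the space of Borel measurable maps $X\to Y$ modulo equality $m$-a.e., with the distance $d(u,v)=\int_X \min(d_Y(u(x),v(x)),1)\,m(\mathrm{d}x)$. Let $\mathcal M_{\pi_1\to m}(X\times Y)$ be the set of finite non-negative Borel measures on $X\times Y$ whose first marginal is $m$, with the topology of narrow convergence, and for $u\in L^0(X,Y;m)$ let $\mu_u=(\mathrm{Id},u)_\# m\in\mathcal M_{\pi_1\to m}(X\times Y)$. Let $E:L^0(X,Y;m)\to[0,+\infty]$ be lower semicontinuous and such that, for every function $\psi:Y\to[0,+\infty]$ with compact sublevel sets $\{\psi\le c\}$, $c\in[0,+\infty)$, the function $u\mapsto E(u)+\int_X\psi(u(x))\,m(\mathrm{d}x)$ has relatively compact sublevel sets (for levels $c\in[0,+\infty)$) in $L^0(X,Y;m)$. For $\mu\in\mathcal M_{\pi_1\to m}(X\times Y)$ let $\Pi(\mu)$ be the set of Borel probability measures $Q$ on $L^0(X,Y;m)$ such that $$\int_{X\times Y}\varphi\,\mathrm{d}\mu=\int_{L^0(X,Y;m)}\Big(\int_X\varphi(x,u(x))\,m(\mathrm{d}x)\Big)Q(\mathrm{d}u)\qquad\text{for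 all }\varphi\in C_b(X\times Y),$$ and set $$\mathcal T_E(\mu)=\inf\Big\{\int_{L^0(X,Y;m)}E(u)\,Q(\mathrm{d}u)\ :\ Q\in\Pi(\mu)\Big\},$$ with $\inf\emptyset=+\infty$. Let $\widetilde{\mathcal T}_E(\mu)=E(u)$ if $\mu=\mu_u$ for some $u\in L^0(X,Y;m)$, and $\widetilde{\mathcal T}_E(\mu)=+\infty$ otherwise. Then: 1. $\mathcal T_E$ is the convex and lower semicontinuous envelope of $\widetilde{\mathcal T}_E$ on $\mathcal M_{\pi_1\to m}(X\times Y)$, that is, the largest convex and (narrowly) lower semicontinuous functional $\mathcal M_{\pi_1\to m}(X\times Y)\to[0,+\infty]$ that is $\le\widetilde{\mathcal T}_E$. 2. $\mathcal T_E(\mu_u)=\widetilde{\mathcal T}_E(\mu_u)=E(u)$ for all $u\in L^0(X,Y;m)$. 3. If $m\neq 0$, then for every $\mu\in\mathcal M_{\pi_1\to m}(X\times Y)$ $$\mathcal T_E(\mu)=\sup\Big\{\int_{X\times Y}\varphi\,\mathrm{d}\mu\ :\ \varphi\in C_b(X\times Y),\ \int_X\varphi(x,u(x))\,m(\mathrm{d}x)\le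 E(u)\ \text{ for all } u\in L^0(X,Y;m)\Big\}.$$ -/

import Mathlib

open MeasureTheory Filter Topology
open scoped NNReal ENNReal BoundedContinuousFunction

noncomputable section

namespace MultimarginalOT

/-- `L⁰(X, Y; m)`: measurable maps `X → Y` modulo equality `m`-almost everywhere. -/
def L0 (X Y : Type*) [MeasurableSpace X] [TopologicalSpace Y] (m : Measure X) : Type _ :=
  X →ₘ[m] Y

section Space

variable {X Y : Type*} [MeasurableSpace X]

/-- A (strongly) measurable representative of a class in `L⁰(X, Y; m)`. -/
instance [TopologicalSpace Y] (m : Measure X) : CoeFun (L0 X Y m) fun _ => X → Y :=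
  ⟨fun u => AEEqFun.cast (show X →ₘ[m] Y from u)⟩

theorem L0.stronglyMeasurable [TopologicalSpace Y] {m : Measure X} (u : L0 X Y m) :
    StronglyMeasurable (u : X → Y) :=
  AEEqFun.stronglyMeasurable (show X →ₘ[m] Y from u)

theorem L0.measurable [TopologicalSpace Y] [TopologicalSpace.PseudoMetrizableSpace Y]
    [MeasurableSpace Y] [BorelSpace Y] {m : Measure X} (u : L0 X Y m) :
    Measurable (u : X → Y) :=
  u.stronglyMeasurable.measurable

theorem L0.ext [TopologicalSpace Y] {m : Measure X} {u v : L0 X Y m}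
    (h : (u : X → Y) =ᵐ[m] v) : u = v :=
  AEEqFun.ext (f := (show X →ₘ[m] Y from u)) (g := (show X →ₘ[m] Y from v)) h

variable [MetricSpace Y] {m : Measure X}

theorem L0.integrable_min_dist [IsFiniteMeasure m] (u v : L0 X Y m) :
    Integrable (fun x => min (dist (u x) (v x)) 1) m := by
  refine Integrable.of_bound (C := 1) ?_ (Eventually.of_forall fun x => ?_)
  · exact ((u.stronglyMeasurable.dist v.stronglyMeasurable).inf
      stronglyMeasurable_const).aestronglyMeasurable
  · rw [Real.norm_eq_abs, abs_of_nonneg (le_min dist_nonneg zero_le_one)]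
    exact min_le_right _ _

/-- The distance `d(u, v) = ∫ min (d_Y(u(x), v(x)), 1) dm` of convergence in measure. -/
instance L0.instMetricSpace [IsFiniteMeasure m] : MetricSpace (L0 X Y m) where
  dist u v := ∫ x, min (dist (u x) (v x)) 1 ∂m
  dist_self u := by simp
  dist_comm u v := by simp only [dist_comm]
  dist_triangle u v w := by
    rw [← integral_add (integrable_min_dist u v) (integrable_min_dist v w)]
    refine integral_mono (integrable_min_dist u w)
      ((integrable_min_dist u v).add (integrable_min_dist v w)) fun x => ?_
    have h := dist_triangle (u x) (v x) (w x)
    have h1 : 0 ≤ dist (u x) (v x) := dist_nonneg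
    have h2 : 0 ≤ dist (v x) (w x) := dist_nonneg
    change min (dist (u x) (w x)) 1 ≤ min (dist (u x) (v x)) 1 + min (dist (v x) (w x)) 1
    rcases min_cases (dist (u x) (v x)) 1 with h3 | h3 <;>
    rcases min_cases (dist (v x) (w x)) 1 with h4 | h4 <;>
    rcases min_cases (dist (u x) (w x)) 1 with h5 | h5 <;> linarith
  eq_of_dist_eq_zero {u v} h := by
    change ∫ x, min (dist (u x) (v x)) 1 ∂m = 0 at h
    rw [integral_eq_zero_iff_of_nonneg (fun x => le_min dist_nonneg zero_le_one)
      (integrable_min_dist u v)] at h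
    refine L0.ext (h.mono fun x hx => ?_)
    have hx' : min (dist (u x) (v x)) 1 = 0 := hx
    rcases min_choice (dist (u x) (v x)) 1 with h1 | h1 <;> rw [h1] at hx'
    · exact dist_eq_zero.1 hx'
    · exact absurd hx' one_ne_zero

instance L0.instMeasurableSpace [IsFiniteMeasure m] : MeasurableSpace (L0 X Y m) :=
  borel _

instance L0.instBorelSpace [IsFiniteMeasure m] : BorelSpace (L0 X Y m) :=
  ⟨rfl⟩

end Space

section Envelope

/-- `G` is the convex and lower semicontinuous envelope of `F` on `s`: the largest functional
with values in `[0, ∞]` on `s` that is convex, lower semicontinuous and below `F`.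
Only the values on `s` matter. -/
def IsConvexLscEnvelopeOn {V : Type*} [AddCommMonoid V] [Module ℝ≥0 V] [TopologicalSpace V]
    (s : Set V) (F G : V → ℝ≥0∞) : Prop :=
  (ConvexOn ℝ≥0 s G ∧ LowerSemicontinuousOn G s ∧ ∀ v ∈ s, G v ≤ F v) ∧
    ∀ H : V → ℝ≥0∞, ConvexOn ℝ≥0 s H → LowerSemicontinuousOn H s → (∀ v ∈ s, H v ≤ F v) →
      ∀ v ∈ s, H v ≤ G v

end Envelope

section Transport

variable {X Y : Type*} [TopologicalSpace X] [MeasurableSpace X] [MetricSpace Y]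
  [MeasurableSpace Y] [BorelSpace Y] {m : Measure X} [IsFiniteMeasure m]

/-- The finite non-negative measures on `X × Y` whose first marginal is `m`
(measure-valued maps `X → 𝒫(Y)`), inside `FiniteMeasure (X × Y)` with the narrow topology. -/
def measuresWithFirstMarginal (Y : Type*) [MeasurableSpace Y] (m : Measure X) :
    Set (FiniteMeasure (X × Y)) :=
  {μ | (μ : Measure (X × Y)).map Prod.fst = m}

/-- The measure `μ_u = (Id, u)_# m`, that is `x ↦ δ_{u(x)}`. -/
def graphMeasure (u : L0 X Y m) : FiniteMeasure (X × Y) :=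
  ⟨m.map fun x => (x, u x), inferInstance⟩

/-- The coercivity assumption on `E`: it is lower semicontinuous, and for every
`ψ : Y → [0, ∞]` with compact sublevel sets, `u ↦ E(u) + ∫ ψ(u(x)) dm` has relatively compact
sublevel sets in `L⁰(X, Y; m)`. The value `∞` is allowed for `ψ`: a finite `ψ` with compact
sublevel sets exists only if `Y` is σ-compact. -/
def IsLscCoercive (E : L0 X Y m → ℝ≥0∞) : Prop :=
  LowerSemicontinuous E ∧
    ∀ ψ : Y → ℝ≥0∞, (∀ c : ℝ≥0, IsCompact {y | ψ y ≤ c}) →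
      ∀ c : ℝ≥0, IsCompact (closure {u : L0 X Y m | E u + ∫⁻ x, ψ (u x) ∂m ≤ c})

/-- `Π(μ)`: the probability measures `Q` on `L⁰(X, Y; m)` with marginals `μ`. -/
def plans (μ : FiniteMeasure (X × Y)) : Set (ProbabilityMeasure (L0 X Y m)) :=
  {Q | ∀ φ : (X × Y) →ᵇ ℝ,
    ∫ z, φ z ∂(μ : Measure (X × Y)) =
      ∫ u, (∫ x, φ (x, u x) ∂m) ∂(Q : Measure (L0 X Y m))}

/-- The multimarginal optimal transport cost `𝒯_E`. -/
def transportCost (E : L0 X Y m → ℝ≥0∞) (μ : FiniteMeasure (X × Y)) : ℝ≥0∞ :=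
  ⨅ Q ∈ plans (m := m) μ, ∫⁻ u, E u ∂(Q : Measure (L0 X Y m))

open Classical in
/-- The functional `E(u)` at `μ_u` and `∞` at measures that are not of this form. -/
def diracLift (E : L0 X Y m → ℝ≥0∞) (μ : FiniteMeasure (X × Y)) : ℝ≥0∞ :=
  if h : ∃ u : L0 X Y m, graphMeasure u = μ then E h.choose else ∞

/-- The dual competitors: bounded continuous `φ` with `∫ φ(x, u(x)) dm ≤ E(u)` for all `u`. -/
def dualAdmissible (E : L0 X Y m → ℝ≥0∞) : Set ((X × Y) →ᵇ ℝ) :=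
  {φ | ∀ u : L0 X Y m, ((∫ x, φ (x, u x) ∂m : ℝ) : EReal) ≤ (E u : EReal)}

end Transport

end MultimarginalOT

end

/-!
The transport cost `𝒯_E` is convex because plans can be mixed. It agrees with `E` at a graph measure
`μ_u` because the Dirac mass at `u` is the only plan of `μ_u`: a plan `Q` of `μ` satisfies
`μ = ∫ μ_v Q(dv)` as an identity of measures (`bind_graphMeasure_of_mem_plans`), so that the
function `(x, y) ↦ d(y, u(x))` can be integrated on both sides.

Lower semicontinuity (`lowerSemicontinuousOn_transportCost`) is a compactness argument. All
measures with first marginal `m` have the same mass, so their narrow topology is that of a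
metrizable space of probability measures and sequences suffice. The second marginals of a convergent
sequence `ν n` are tight; the compact sets capturing their mass give a function `ψ` with compact
sublevel sets and bounded integrals `∫ ψ(y) ν n(dx dy)`. If `Q n` is a plan of `ν n` with bounded
cost, the mean of `u ↦ E(u) + ∫ ψ(u) dm` under `Q n` is bounded. By coercivity and Markov's inequality
the `Q n` are tight, and by Prokhorov's theorem they have a limit point, which is a plan of the limit
with no larger cost because `E` is a supremum of bounded continuous functions
(`lowerSemicontinuous_lintegral`).

The rest is Fenchel–Moreau duality (`exists_minorant`): a convex lower semicontinuous functional
`H ≥ 0` on the measures with first marginal `m ≠ 0` is the supremum of the functionals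
`μ ↦ ∫ φ dμ ≤ H` with `φ` bounded and continuous. A narrow neighbourhood only involves finitely many
test functions, so a Hahn–Banach separation in a finite-dimensional space produces `φ` directly as a
linear combination of these. For `H = 𝒯_E` this is the dual formula. For an arbitrary `H` below `E` on
graph measures, integrating a minorant `φ` against a plan gives Jensen's inequality
`H(μ) ≤ ∫ E dQ`, hence `H ≤ 𝒯_E`.
-/

namespace MultimarginalOT

/-! ### Graph measures and plans -/

section Graph

variable {X Y : Type*} [MeasurableSpace X] [MetricSpace Y] {m : Measure X}

/-- A sequence converging in `L⁰` has a subsequence converging almost everywhere: apply the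
subsequence principle for convergence in `L¹` to the truncated distances. -/
theorem L0.exists_subseq_tendsto_ae [IsFiniteMeasure m] {v : ℕ → L0 X Y m} {u : L0 X Y m}
    (h : Tendsto v atTop (𝓝 u)) :
    ∃ ns : ℕ → ℕ, ∀ᵐ x ∂m, Tendsto (fun i => v (ns i) x) atTop (𝓝 (u x)) := by
  have hd : Tendsto (fun n => ∫ x, min (dist (v n x) (u x)) 1 ∂m) atTop (𝓝 0) :=
    tendsto_iff_dist_tendsto_zero.1 h
  have hn : Tendsto (fun n => eLpNorm ((fun x => min (dist (v n x) (u x)) 1) - 0) 1 m) atTop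
      (𝓝 0) := by
    have h0 := ENNReal.tendsto_ofReal hd
    rw [ENNReal.ofReal_zero] at h0
    refine h0.congr fun n => ?_
    rw [sub_zero, eLpNorm_one_eq_lintegral_enorm,
      ofReal_integral_eq_lintegral_ofReal (integrable_min_dist _ _)
        (Eventually.of_forall fun x => le_min dist_nonneg zero_le_one)]
    refine lintegral_congr fun x => ?_
    rw [Real.enorm_eq_ofReal (le_min dist_nonneg zero_le_one)]
  obtain ⟨ns, -, hns⟩ := (tendstoInMeasure_of_tendsto_eLpNorm one_ne_zero
    (fun n => (integrable_min_dist (v n) u).aestronglyMeasurable)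
    aestronglyMeasurable_zero hn).exists_seq_tendsto_ae
  refine ⟨ns, hns.mono fun x hx => ?_⟩
  rw [tendsto_iff_dist_tendsto_zero]
  have hx' : Tendsto (fun i => min (dist (v (ns i) x) (u x)) 1) atTop (𝓝 0) := hx
  refine hx'.congr' ?_
  filter_upwards [hx'.eventually (gt_mem_nhds one_pos)] with i hi
  exact min_eq_left ((min_lt_iff.1 hi).resolve_right (lt_irrefl _)).le

theorem norm_integral_graph_le [TopologicalSpace X] [IsFiniteMeasure m] (φ : (X × Y) →ᵇ ℝ)
    (u : L0 X Y m) :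
    ‖∫ x, φ (x, u x) ∂m‖ ≤ ‖φ‖ * m.real Set.univ :=
  norm_integral_le_of_norm_le_const (Eventually.of_forall fun _ => φ.norm_coe_le_norm _)

variable [MeasurableSpace Y] [BorelSpace Y]

theorem L0.measurable_graph (u : L0 X Y m) : Measurable fun x => (x, u x) :=
  measurable_id.prodMk u.measurable

variable [IsFiniteMeasure m]

theorem lintegral_graphMeasure (u : L0 X Y m) {f : X × Y → ℝ≥0∞} (hf : Measurable f) :
    ∫⁻ z, f z ∂(graphMeasure u : Measure (X × Y)) = ∫⁻ x, f (x, u x) ∂m :=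
  lintegral_map hf u.measurable_graph

theorem graphMeasure_mem (u : L0 X Y m) : graphMeasure u ∈ measuresWithFirstMarginal Y m := by
  change (m.map fun x => (x, u x)).map Prod.fst = m
  rw [Measure.map_map measurable_fst u.measurable_graph]
  exact Measure.map_id

variable [TopologicalSpace X] [OpensMeasurableSpace (X × Y)]

theorem integral_graphMeasure (u : L0 X Y m) (φ : (X × Y) →ᵇ ℝ) :
    ∫ z, φ z ∂(graphMeasure u : Measure (X × Y)) = ∫ x, φ (x, u x) ∂m :=
  integral_map u.measurable_graph.aemeasurable
    φ.continuous.measurable.aestronglyMeasurable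

theorem continuous_integral_graph (φ : (X × Y) →ᵇ ℝ) :
    Continuous fun u : L0 X Y m => ∫ x, φ (x, u x) ∂m := by
  refine SeqContinuous.continuous fun v u hv => ?_
  refine tendsto_of_subseq_tendsto fun ns hns => ?_
  obtain ⟨ms, hms⟩ := L0.exists_subseq_tendsto_ae (hv.comp hns)
  refine ⟨ms, tendsto_integral_of_dominated_convergence (fun _ => ‖φ‖) (fun n => ?_)
    (integrable_const _) (fun n => Eventually.of_forall fun x => φ.norm_coe_le_norm _) ?_⟩
  · exact (φ.continuous.measurable.comp (L0.measurable_graph _)).aestronglyMeasurable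
  · filter_upwards [hms] with x hx
    exact (φ.continuous.tendsto _).comp (tendsto_const_nhds.prodMk_nhds hx)

theorem integrable_integral_graph (Q : ProbabilityMeasure (L0 X Y m)) (φ : (X × Y) →ᵇ ℝ) :
    Integrable (fun u : L0 X Y m => ∫ x, φ (x, u x) ∂m) (Q : Measure (L0 X Y m)) :=
  Integrable.of_bound (continuous_integral_graph φ).measurable.aestronglyMeasurable _
    (Eventually.of_forall (norm_integral_graph_le φ))

theorem continuous_graphMeasure : Continuous (graphMeasure : L0 X Y m → FiniteMeasure (X × Y)) := by
  rw [FiniteMeasure.continuous_iff_forall_continuous_integral]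
  intro φ
  simp only [integral_graphMeasure]
  exact continuous_integral_graph φ

theorem dirac_mem_plans (u : L0 X Y m) :
    (⟨Measure.dirac u, inferInstance⟩ : ProbabilityMeasure (L0 X Y m)) ∈
      plans (graphMeasure u) := by
  intro φ
  rw [integral_graphMeasure]
  exact (integral_dirac (fun v : L0 X Y m => ∫ x, φ (x, v x) ∂m) u).symm

variable [HasOuterApproxClosed (X × Y)] [BorelSpace (X × Y)]

theorem measurable_graphMeasure :
    Measurable fun u : L0 X Y m => (graphMeasure u : Measure (X × Y)) := by
  have key : ∀ F : Set (X × Y), IsClosed F →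
      Measurable fun u : L0 X Y m => (graphMeasure u : Measure (X × Y)) F := fun F hF => by
    refine measurable_of_tendsto_metrizable (f := fun n u =>
      ∫⁻ z, hF.apprSeq n z ∂(graphMeasure u : Measure (X × Y))) (fun n => ?_) ?_
    · exact ((FiniteMeasure.continuous_lintegral_boundedContinuousFunction _).comp
        continuous_graphMeasure).measurable
    · exact tendsto_pi_nhds.2 fun u => HasOuterApproxClosed.tendsto_lintegral_apprSeq hF _
  exact Measurable.measure_of_isPiSystem
    ((BorelSpace.measurable_eq (α := X × Y)).trans borel_eq_generateFrom_isClosed)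
    isPiSystem_isClosed key (key _ isClosed_univ)

theorem measurable_lintegral_graph {f : X × Y → ℝ≥0∞} (hf : Measurable f) :
    Measurable fun u : L0 X Y m => ∫⁻ x, f (x, u x) ∂m := by
  simp only [← lintegral_graphMeasure _ hf]
  exact (Measure.measurable_lintegral hf).comp measurable_graphMeasure

/-- A plan `Q ∈ Π(μ)` disintegrates `μ` into graph measures: the identity defining `Π(μ)` for
bounded continuous functions holds as an identity of measures. -/
theorem bind_graphMeasure_of_mem_plans {μ : FiniteMeasure (X × Y)}
    {Q : ProbabilityMeasure (L0 X Y m)} (hQ : Q ∈ plans μ) :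
    (Q : Measure (L0 X Y m)).bind (fun u => (graphMeasure u : Measure (X × Y))) = μ := by
  refine (ext_of_forall_lintegral_eq_of_IsFiniteMeasure fun f => ?_).symm
  rw [Measure.lintegral_bind measurable_graphMeasure.aemeasurable
    (f.continuous.measurable.coe_nnreal_ennreal.aemeasurable)]
  have hreal : ∀ ν : FiniteMeasure (X × Y), ∫⁻ z, (f z : ℝ≥0∞) ∂(ν : Measure (X × Y)) =
      ENNReal.ofReal (∫ z, (f z : ℝ) ∂(ν : Measure (X × Y))) := fun ν => by
    rw [← f.toReal_lintegral_coe_eq_integral (ν : Measure (X × Y)), ENNReal.ofReal_toReal]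
    exact (f.lintegral_lt_top_of_nnreal _).ne
  obtain ⟨g, hg⟩ : ∃ g : (X × Y) →ᵇ ℝ, ∀ z, g z = f z :=
    ⟨f.comp _ NNReal.isometry_coe.lipschitz, fun z => rfl⟩
  simp only [hreal, ← hg]
  rw [hQ g, ofReal_integral_eq_lintegral_ofReal]
  · simp only [integral_graphMeasure]
  · exact integrable_integral_graph Q g
  · exact Eventually.of_forall fun u => integral_nonneg fun x =>
      (hg (x, u x)).symm ▸ NNReal.coe_nonneg _

theorem lintegral_eq_of_mem_plans {μ : FiniteMeasure (X × Y)}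
    {Q : ProbabilityMeasure (L0 X Y m)} (hQ : Q ∈ plans μ) {f : X × Y → ℝ≥0∞}
    (hf : Measurable f) :
    ∫⁻ z, f z ∂(μ : Measure (X × Y)) =
      ∫⁻ u, (∫⁻ x, f (x, u x) ∂m) ∂(Q : Measure (L0 X Y m)) := by
  rw [← bind_graphMeasure_of_mem_plans hQ,
    Measure.lintegral_bind measurable_graphMeasure.aemeasurable hf.aemeasurable]
  simp only [lintegral_graphMeasure _ hf]

variable [SecondCountableTopology Y]

/-- The only plan of `μ_u` is the Dirac mass at `u`: test it against the function
`(x, y) ↦ d(y, u(x))`, whose integral vanishes at `μ_u`. -/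
theorem ae_eq_of_mem_plans_graphMeasure {u : L0 X Y m} {Q : ProbabilityMeasure (L0 X Y m)}
    (hQ : Q ∈ plans (graphMeasure u)) : ∀ᵐ v ∂(Q : Measure (L0 X Y m)), v = u := by
  have hf : Measurable fun z : X × Y => edist z.2 (u z.1) :=
    measurable_snd.edist (u.measurable.comp measurable_fst)
  have h := lintegral_eq_of_mem_plans hQ hf
  rw [lintegral_graphMeasure u hf] at h
  simp only [edist_self, lintegral_zero] at h
  have h' := (lintegral_eq_zero_iff (measurable_lintegral_graph hf)).1 h.symm
  filter_upwards [h'] with v hv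
  refine L0.ext ?_
  filter_upwards [(lintegral_eq_zero_iff (hf.comp v.measurable_graph)).1 hv] with x hx
  exact edist_eq_zero.1 hx

theorem graphMeasure_injective :
    Function.Injective (graphMeasure : L0 X Y m → FiniteMeasure (X × Y)) := by
  intro u v h
  have hQ := dirac_mem_plans u
  rw [h] at hQ
  have := ae_eq_of_mem_plans_graphMeasure hQ
  have h' : ∀ᵐ w ∂(Measure.dirac u : Measure (L0 X Y m)), w = v := this
  rwa [ae_dirac_eq] at h'

theorem diracLift_graphMeasure (E : L0 X Y m → ℝ≥0∞) (u : L0 X Y m) :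
    diracLift E (graphMeasure u) = E u := by
  have h : ∃ v : L0 X Y m, graphMeasure v = graphMeasure u := ⟨u, rfl⟩
  rw [diracLift, dif_pos h, graphMeasure_injective h.choose_spec]

theorem transportCost_graphMeasure (E : L0 X Y m → ℝ≥0∞) (u : L0 X Y m) :
    transportCost E (graphMeasure u) = E u := by
  have key : ∀ Q ∈ plans (graphMeasure u),
      ∫⁻ v, E v ∂((Q : ProbabilityMeasure (L0 X Y m)) : Measure (L0 X Y m)) = E u := fun Q hQ => by
    have h : E =ᵐ[(Q : Measure (L0 X Y m))] fun _ => E u :=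
      (ae_eq_of_mem_plans_graphMeasure hQ).mono fun v hv => congrArg E hv
    rw [lintegral_congr_ae h, lintegral_const, measure_univ, mul_one]
  refine le_antisymm ?_ (le_iInf₂ fun Q hQ => (key Q hQ).ge)
  exact (iInf₂_le _ (dirac_mem_plans u)).trans_eq (key _ (dirac_mem_plans u))

theorem transportCost_le_diracLift (E : L0 X Y m → ℝ≥0∞) (μ : FiniteMeasure (X × Y)) :
    transportCost E μ ≤ diracLift E μ := by
  by_cases h : ∃ u : L0 X Y m, graphMeasure u = μ
  · obtain ⟨u, rfl⟩ := h
    rw [transportCost_graphMeasure, diracLift_graphMeasure]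
  · rw [diracLift, dif_neg h]
    exact le_top

end Graph

/-! ### Lower semicontinuity of integrals of lower semicontinuous functions -/

section LscIntegral

variable {S : Type*}

/-- The infimal convolution of `min (F, k)` with `k` times the distance: the `k`-th Lipschitz
approximation from below of a lower semicontinuous function `F`. -/
noncomputable def lipschitzApprox [PseudoEMetricSpace S] (F : S → ℝ≥0∞) (k : ℕ) (u : S) : ℝ≥0∞ :=
  ⨅ v, (min (F v) k + k * edist u v)

section Approx

variable [PseudoEMetricSpace S] (F : S → ℝ≥0∞)

theorem lipschitzApprox_le_self (k : ℕ) (u : S) : lipschitzApprox F k u ≤ F u :=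
  (iInf_le _ u).trans (by simp)

theorem lipschitzApprox_le_nat (k : ℕ) (u : S) : lipschitzApprox F k u ≤ k :=
  (iInf_le _ u).trans (by simp)

theorem monotone_lipschitzApprox : Monotone (lipschitzApprox F) := by
  intro k l hkl u
  have h : (k : ℝ≥0∞) ≤ l := by exact_mod_cast hkl
  exact iInf_mono fun v => add_le_add (min_le_min_left _ h) (mul_le_mul_left h _)

theorem continuous_lipschitzApprox (k : ℕ) : Continuous (lipschitzApprox F k) := by
  refine continuous_of_le_add_edist k (ENNReal.natCast_ne_top k) fun u w => ?_
  rw [lipschitzApprox, lipschitzApprox, ENNReal.iInf_add]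
  refine iInf_mono fun v => ?_
  rw [add_assoc, ← mul_add, add_comm (edist w v)]
  gcongr
  exact edist_triangle u w v

variable {F}

theorem iSup_lipschitzApprox (hF : LowerSemicontinuous F) (u : S) :
    ⨆ k, lipschitzApprox F k u = F u := by
  refine le_antisymm (iSup_le fun k => lipschitzApprox_le_self F k u) ?_
  refine le_of_forall_lt fun t ht => ?_
  obtain ⟨t', htt', ht'⟩ := exists_between ht
  refine htt'.trans_le ?_
  obtain ⟨δ₀, hδ₀, hball⟩ := Metric.nhds_basis_eball.eventually_iff.1 (hF u t' ht')
  obtain ⟨δ, hδ, hδδ₀⟩ := exists_between hδ₀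
  have htop : t' ≠ ∞ := (ht'.trans_le le_top).ne
  -- `k ≥ t'` handles the points `v` near `u`, and `k * δ ≥ t'` those away from `u`.
  obtain ⟨k, hk⟩ := ENNReal.exists_nat_gt (max_lt htop.lt_top
    (ENNReal.div_lt_top htop hδ.ne')).ne
  refine le_iSup_of_le k (le_iInf fun v => ?_)
  by_cases hv : edist v u < δ
  · exact le_add_right (le_min (hball (hv.trans hδδ₀)).le ((le_max_left _ _).trans hk.le))
  · refine le_add_left ?_
    rw [not_lt, edist_comm] at hv
    calc t' ≤ t' / δ * δ := (ENNReal.div_mul_cancel hδ.ne' (hδδ₀.trans_le le_top).ne).ge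
      _ ≤ k * edist u v := mul_le_mul' ((le_max_right _ _).trans hk.le) hv

end Approx

/-- The integral of a non-negative lower semicontinuous function is a lower semicontinuous
function of the measure, being a supremum of integrals of bounded continuous functions. -/
theorem lowerSemicontinuous_lintegral [PseudoEMetricSpace S] [MeasurableSpace S]
    [OpensMeasurableSpace S] {F : S → ℝ≥0∞} (hF : LowerSemicontinuous F) :
    LowerSemicontinuous fun Q : ProbabilityMeasure S => ∫⁻ u, F u ∂(Q : Measure S) := by
  have h : (fun Q : ProbabilityMeasure S => ∫⁻ u, F u ∂(Q : Measure S)) =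
      fun Q : ProbabilityMeasure S => ⨆ k, ∫⁻ u, lipschitzApprox F k u ∂(Q : Measure S) := by
    funext Q
    rw [← lintegral_iSup (fun k => (continuous_lipschitzApprox F k).measurable)
      (monotone_lipschitzApprox F)]
    simp only [iSup_lipschitzApprox hF]
  rw [h]
  refine lowerSemicontinuous_iSup fun k => Continuous.lowerSemicontinuous ?_
  have htop : ∀ u, lipschitzApprox F k u ≠ ∞ := fun u =>
    ne_top_of_le_ne_top (ENNReal.natCast_ne_top k) (lipschitzApprox_le_nat F k u)
  let g : S →ᵇ ℝ≥0 := BoundedContinuousFunction.mkOfBound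
    ⟨fun u => (lipschitzApprox F k u).toNNReal,
      ENNReal.continuousOn_toNNReal.comp_continuous (continuous_lipschitzApprox F k) htop⟩ k
    fun u v => by
      have hb : ∀ w, ((lipschitzApprox F k w).toNNReal : ℝ) ≤ k := fun w => by
        exact_mod_cast ENNReal.toNNReal_mono (ENNReal.natCast_ne_top k)
          (lipschitzApprox_le_nat F k w)
      exact (Real.dist_le_of_mem_Icc ⟨NNReal.coe_nonneg _, hb u⟩
        ⟨NNReal.coe_nonneg _, hb v⟩).trans (sub_zero (k : ℝ)).le
  have hg : ∀ u, lipschitzApprox F k u = g u := fun u => (ENNReal.coe_toNNReal (htop u)).symm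
  simp only [hg]
  exact ProbabilityMeasure.continuous_lintegral_boundedContinuousFunction g

end LscIntegral

/-! ### Tightness criteria -/

section Compactness

/-- For compact sets `K n`, the number of indices `n` with `y ∉ K n` is a function of `y` with
compact sublevel sets. -/
theorem isCompact_sublevel_tsum_indicator_compl {Y : Type*} [TopologicalSpace Y] [T2Space Y]
    {K : ℕ → Set Y} (hK : ∀ n, IsCompact (K n)) (c : ℝ≥0) :
    IsCompact {y | ∑' n, (K n)ᶜ.indicator (fun _ => (1 : ℝ≥0∞)) y ≤ c} := by
  obtain ⟨N, hN⟩ := exists_nat_gt c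
  have hlsc : LowerSemicontinuous fun y => ∑' n, (K n)ᶜ.indicator (fun _ => (1 : ℝ≥0∞)) y :=
    lowerSemicontinuous_tsum fun n =>
      (hK n).isClosed.isOpen_compl.lowerSemicontinuous_indicator zero_le_one
  refine ((Finset.range N).isCompact_biUnion fun n _ => hK n).of_isClosed_subset
    (hlsc.isClosed_preimage c) fun y hy => ?_
  -- A point outside of `K 0, …, K (N - 1)` has value at least `N > c`.
  by_contra h
  simp only [Set.mem_iUnion, not_exists] at h
  have h1 : (N : ℝ≥0∞) ≤ ∑' n, (K n)ᶜ.indicator (fun _ => (1 : ℝ≥0∞)) y := by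
    calc (N : ℝ≥0∞) = ∑ n ∈ Finset.range N, (K n)ᶜ.indicator (fun _ => (1 : ℝ≥0∞)) y := by
          rw [Finset.sum_congr rfl fun n hn => Set.indicator_of_mem (h n hn) _]
          simp
      _ ≤ _ := ENNReal.sum_le_tsum _
  exact absurd (h1.trans hy) (not_le.2 (by exact_mod_cast hN))

theorem isTightMeasureSet_range_of_tendsto {Y : Type*} [MetricSpace Y] [CompleteSpace Y]
    [SecondCountableTopology Y] [MeasurableSpace Y] [BorelSpace Y]
    {P : ℕ → ProbabilityMeasure Y} {P₀ : ProbabilityMeasure Y} (h : Tendsto P atTop (𝓝 P₀)) :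
    IsTightMeasureSet {((ν : ProbabilityMeasure Y) : Measure Y) | ν ∈ Set.range P} :=
  (isTightMeasureSet_of_isCompact_closure
    (h.isCompact_insert_range.isClosed.closure_eq.symm ▸ h.isCompact_insert_range)).subset
    (by rintro _ ⟨ν, hν, rfl⟩; exact ⟨ν, Set.mem_insert_of_mem _ hν, rfl⟩)

/-- If a function with relatively compact sublevel sets has bounded mean along a family of
probability measures, the family is tight. -/
theorem isTightMeasureSet_of_lintegral_le {S : Type*} [MetricSpace S] [MeasurableSpace S]
    [BorelSpace S] {F : S → ℝ≥0∞} (hF : Measurable F)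
    (hc : ∀ c : ℝ≥0, IsCompact (closure {u | F u ≤ c})) {T : Set (Measure S)} {D : ℝ≥0∞}
    (hD : D ≠ ∞) (hT : ∀ Q ∈ T, ∫⁻ u, F u ∂Q ≤ D) : IsTightMeasureSet T := by
  rw [isTightMeasureSet_iff_exists_isCompact_measure_compl_le]
  intro ε hε
  obtain ⟨M, hM⟩ := ENNReal.exists_nat_gt (ENNReal.div_lt_top hD hε.ne').ne
  refine ⟨_, hc M, fun Q hQ => ?_⟩
  have hM0 : (M : ℝ≥0∞) ≠ 0 := (bot_le.trans_lt hM).ne'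
  have hsub : (closure {u | F u ≤ (M : ℝ≥0)})ᶜ ⊆ {u | (M : ℝ≥0∞) ≤ F u} := fun u hu => by
    by_contra h
    exact hu (subset_closure (by simpa using (not_le.1 h).le))
  calc Q _ ≤ Q {u | (M : ℝ≥0∞) ≤ F u} := measure_mono hsub
    _ ≤ (∫⁻ u, F u ∂Q) / M := meas_ge_le_lintegral_div hF.aemeasurable hM0
      (ENNReal.natCast_ne_top M)
    _ ≤ D / M := ENNReal.div_le_div_right (hT Q hQ) _
    _ ≤ ε := ENNReal.div_le_of_le_mul' ((ENNReal.div_le_iff_le_mul (Or.inl hε.ne') (Or.inr hM0)).1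
      hM.le)

end Compactness

/-! ### Measures with first marginal `m` -/

section FirstMarginal

variable {X Y : Type*} [MeasurableSpace X] [MeasurableSpace Y] {m : Measure X}

theorem apply_univ_of_mem {μ : FiniteMeasure (X × Y)} (hμ : μ ∈ measuresWithFirstMarginal Y m) :
    (μ : Measure (X × Y)) Set.univ = m Set.univ := by
  have h : (μ : Measure (X × Y)).map Prod.fst = m := hμ
  rw [← h, Measure.map_apply measurable_fst .univ, Set.preimage_univ]

theorem mass_of_mem {μ : FiniteMeasure (X × Y)} (hμ : μ ∈ measuresWithFirstMarginal Y m) :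
    μ.mass = (m Set.univ).toNNReal := by
  rw [← apply_univ_of_mem hμ, ← FiniteMeasure.ennreal_mass, ENNReal.toNNReal_coe]

theorem ne_zero_of_mem (hm : m ≠ 0) {μ : FiniteMeasure (X × Y)}
    (hμ : μ ∈ measuresWithFirstMarginal Y m) : μ ≠ 0 := by
  rintro rfl
  apply hm
  rw [← Measure.measure_univ_eq_zero, ← apply_univ_of_mem hμ]
  rfl

theorem nonempty_of_mem (hm : m ≠ 0) {μ : FiniteMeasure (X × Y)}
    (hμ : μ ∈ measuresWithFirstMarginal Y m) : Nonempty (X × Y) := by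
  by_contra h
  rw [not_nonempty_iff] at h
  exact ne_zero_of_mem hm hμ (FiniteMeasure.toMeasure_injective (Subsingleton.elim _ _))

variable [TopologicalSpace X] [TopologicalSpace Y] [OpensMeasurableSpace (X × Y)]

/-- Measures with first marginal `m` all have the mass of `m`, so that normalization embeds them
into the probability measures, whose narrow topology is metrizable. -/
theorem isCountablyGenerated_nhdsWithin [FirstCountableTopology (ProbabilityMeasure (X × Y))]
    (hm : m ≠ 0) {μ : FiniteMeasure (X × Y)} (hμ : μ ∈ measuresWithFirstMarginal Y m) :
    (𝓝[measuresWithFirstMarginal Y m] μ).IsCountablyGenerated := by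
  have : Nonempty (X × Y) := nonempty_of_mem hm hμ
  let f : measuresWithFirstMarginal Y m → ProbabilityMeasure (X × Y) := fun ν => ν.1.normalize
  let g : ProbabilityMeasure (X × Y) → FiniteMeasure (X × Y) := fun P =>
    (m Set.univ).toNNReal • P.toFiniteMeasure
  have hf : Continuous f := continuous_iff_continuousAt.2 fun ν =>
    FiniteMeasure.tendsto_normalize_of_tendsto continuous_subtype_val.continuousAt
      (ne_zero_of_mem hm ν.2)
  have hg : Continuous g :=
    (continuous_const_smul _).comp ProbabilityMeasure.toFiniteMeasure_continuous
  have hgf : g ∘ f = Subtype.val := by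
    funext ν
    change (m Set.univ).toNNReal • ν.1.normalize.toFiniteMeasure = ν.1
    rw [← mass_of_mem ν.2, ← FiniteMeasure.self_eq_mass_smul_normalize]
  have hind : IsInducing f := IsInducing.of_comp hf hg (hgf ▸ IsInducing.subtypeVal)
  have := hind.firstCountableTopology
  rw [← map_nhds_subtype_val (⟨μ, hμ⟩ : measuresWithFirstMarginal Y m)]
  infer_instance

end FirstMarginal

/-! ### Compactness of plans and lower semicontinuity of the transport cost -/

section LscTransport

variable {X Y : Type*} [TopologicalSpace X] [MeasurableSpace X] [MetricSpace Y]
  [CompleteSpace Y] [SecondCountableTopology Y] [MeasurableSpace Y] [BorelSpace Y]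
  {m : Measure X} [BorelSpace (X × Y)]

/-- The second marginals of a narrowly convergent sequence are tight. -/
theorem exists_isCompact_compl_le_of_tendsto (hm : m ≠ 0)
    {ν : ℕ → FiniteMeasure (X × Y)} (hν : ∀ n, ν n ∈ measuresWithFirstMarginal Y m)
    {μ : FiniteMeasure (X × Y)} (hμ : μ ∈ measuresWithFirstMarginal Y m)
    (h : Tendsto ν atTop (𝓝 μ)) {ε : ℝ≥0∞} (hε : 0 < ε) :
    ∃ K : Set Y, IsCompact K ∧
      ∀ n, (ν n : Measure (X × Y)) (Prod.snd ⁻¹' Kᶜ) ≤ m Set.univ * ε := by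
  have : Nonempty (X × Y) := nonempty_of_mem hm hμ
  have hP : Tendsto (fun n => (ν n).normalize.map (f := Prod.snd) measurable_snd.aemeasurable)
      atTop (𝓝 (μ.normalize.map measurable_snd.aemeasurable)) :=
    ProbabilityMeasure.tendsto_map_of_tendsto_of_continuous _ _
      (FiniteMeasure.tendsto_normalize_of_tendsto h (ne_zero_of_mem hm hμ)) continuous_snd
  obtain ⟨K, hK, hle⟩ := isTightMeasureSet_iff_exists_isCompact_measure_compl_le.1
    (isTightMeasureSet_range_of_tendsto hP) ε hε
  refine ⟨K, hK, fun n => ?_⟩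
  have h1 := hle _ ⟨_, ⟨n, rfl⟩, rfl⟩
  rw [ProbabilityMeasure.toMeasure_map, Measure.map_apply measurable_snd
    hK.measurableSet.compl] at h1
  calc (ν n : Measure (X × Y)) (Prod.snd ⁻¹' Kᶜ)
      = (ν n).mass * ((ν n).normalize : Measure (X × Y)) (Prod.snd ⁻¹' Kᶜ) := by
        rw [← FiniteMeasure.ennreal_coeFn_eq_coeFn_toMeasure,
          ← ProbabilityMeasure.ennreal_coeFn_eq_coeFn_toMeasure,
          FiniteMeasure.self_eq_mass_mul_normalize, ENNReal.coe_mul]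
    _ ≤ m Set.univ * ε := by
        rw [FiniteMeasure.ennreal_mass, apply_univ_of_mem (hν n)]
        gcongr

variable [IsFiniteMeasure m] [HasOuterApproxClosed (X × Y)]

/-- Compactness of plans: along a narrowly convergent sequence, plans with bounded cost are tight,
and a limit point is a plan for the limit with no larger cost. -/
theorem transportCost_le_of_tendsto (hm : m ≠ 0) {E : L0 X Y m → ℝ≥0∞} (hE : IsLscCoercive E)
    {ν : ℕ → FiniteMeasure (X × Y)} (hν : ∀ n, ν n ∈ measuresWithFirstMarginal Y m)
    {μ : FiniteMeasure (X × Y)} (hμ : μ ∈ measuresWithFirstMarginal Y m)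
    (h : Tendsto ν atTop (𝓝 μ)) {c : ℝ≥0∞} (hc : c ≠ ∞)
    (hle : ∀ n, transportCost E (ν n) < c) : transportCost E μ ≤ c := by
  have hQ : ∀ n, ∃ Q ∈ plans (m := m) (ν n), ∫⁻ u, E u ∂(Q : Measure (L0 X Y m)) < c :=
    fun n => by simpa only [transportCost, iInf_lt_iff, exists_prop] using hle n
  choose Q hQp hQc using hQ
  choose K hK hKle using fun j : ℕ => exists_isCompact_compl_le_of_tendsto hm hν hμ h
    (ε := 2⁻¹ ^ j) (ENNReal.pow_pos (by simp) j)
  let ψ : Y → ℝ≥0∞ := fun y => ∑' j, (K j)ᶜ.indicator (fun _ => (1 : ℝ≥0∞)) y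
  have hψm : Measurable ψ := Measurable.tsum fun j =>
    measurable_const.indicator (hK j).measurableSet.compl
  have hψ : ∀ n, ∫⁻ z, ψ z.2 ∂(ν n : Measure (X × Y)) ≤ m Set.univ * 2 := fun n => by
    calc ∫⁻ z, ψ z.2 ∂(ν n : Measure (X × Y))
        = ∑' j, ∫⁻ z, (K j)ᶜ.indicator (fun _ => (1 : ℝ≥0∞)) z.2 ∂(ν n : Measure (X × Y)) :=
          lintegral_tsum (f := fun j (z : X × Y) => (K j)ᶜ.indicator (fun _ => (1 : ℝ≥0∞)) z.2)
            fun j => ((measurable_const.indicator (hK j).measurableSet.compl).comp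
              measurable_snd).aemeasurable
      _ = ∑' j, (ν n : Measure (X × Y)) (Prod.snd ⁻¹' (K j)ᶜ) := by
          refine tsum_congr fun j => ?_
          rw [← lintegral_indicator_one (measurable_snd (hK j).measurableSet.compl)]
          rfl
      _ ≤ ∑' j, m Set.univ * 2⁻¹ ^ j := ENNReal.tsum_le_tsum fun j => hKle j n
      _ = m Set.univ * 2 := by
          rw [ENNReal.tsum_mul_left, ENNReal.tsum_geometric, ENNReal.one_sub_inv_two, inv_inv]
  let F : L0 X Y m → ℝ≥0∞ := fun u => E u + ∫⁻ x, ψ (u x) ∂m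
  have hFm : Measurable F :=
    hE.1.measurable.add (measurable_lintegral_graph (hψm.comp measurable_snd))
  have hF : ∀ n, ∫⁻ u, F u ∂(Q n : Measure (L0 X Y m)) ≤ c + m Set.univ * 2 := fun n => by
    rw [lintegral_add_left hE.1.measurable]
    refine add_le_add (hQc n).le (le_trans (le_of_eq ?_) (hψ n))
    exact (lintegral_eq_of_mem_plans (hQp n) (hψm.comp measurable_snd)).symm
  have htight : IsTightMeasureSet
      {((P : ProbabilityMeasure (L0 X Y m)) : Measure (L0 X Y m)) | P ∈ Set.range Q} := by
    refine isTightMeasureSet_of_lintegral_le hFm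
      (hE.2 ψ (isCompact_sublevel_tsum_indicator_compl hK)) (D := c + m Set.univ * 2)
      (by finiteness) ?_
    rintro _ ⟨_, ⟨n, rfl⟩, rfl⟩
    exact hF n
  obtain ⟨Q₀, -, hQ₀⟩ := (isCompact_closure_of_isTightMeasureSet htight).ultrafilter_le_nhds
    ((hyperfilter ℕ).map Q) (le_principal_iff.2 (mem_map.2 (Eventually.of_forall fun n =>
      subset_closure ⟨n, rfl⟩)))
  have hlim : Tendsto Q (hyperfilter ℕ) (𝓝 Q₀) := hQ₀
  have hν' : Tendsto ν (hyperfilter ℕ) (𝓝 μ) :=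
    h.mono_left (Nat.hyperfilter_le_atTop)
  have hQ₀p : Q₀ ∈ plans μ := fun φ => by
    have h1 := (FiniteMeasure.tendsto_iff_forall_integral_tendsto.1 hν') φ
    have h2 := (ProbabilityMeasure.tendsto_iff_forall_integral_tendsto.1 hlim)
      (BoundedContinuousFunction.ofNormedAddCommGroup _ (continuous_integral_graph φ) _
        (norm_integral_graph_le φ))
    refine tendsto_nhds_unique h1 (h2.congr fun n => ?_)
    exact (hQp n φ).symm
  refine (iInf₂_le Q₀ hQ₀p).trans ?_
  exact ((lowerSemicontinuous_lintegral hE.1).isClosed_preimage c).mem_of_tendsto hlim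
    (Eventually.of_forall fun n => (hQc n).le)

theorem lowerSemicontinuousOn_transportCost
    [FirstCountableTopology (ProbabilityMeasure (X × Y))] {E : L0 X Y m → ℝ≥0∞}
    (hE : IsLscCoercive E) :
    LowerSemicontinuousOn (transportCost E) (measuresWithFirstMarginal Y m) := by
  intro μ hμ t ht
  by_cases hm : m = 0
  · -- The null measure is then the only element of the domain.
    have h0 : ∀ ν ∈ measuresWithFirstMarginal Y m, ν = (0 : FiniteMeasure (X × Y)) := fun ν hν => by
      rw [← FiniteMeasure.mass_zero_iff, mass_of_mem hν, hm]
      simp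
    refine eventually_nhdsWithin_of_forall fun ν hν => ?_
    rwa [h0 ν hν, ← h0 μ hμ]
  · have := isCountablyGenerated_nhdsWithin hm hμ
    obtain ⟨c, htc, hcμ⟩ := exists_between ht
    by_contra hfreq
    obtain ⟨ν, hν, hνt⟩ := exists_seq_forall_of_frequently
      ((not_eventually.1 hfreq).and_eventually self_mem_nhdsWithin)
    refine absurd (transportCost_le_of_tendsto hm hE (fun n => (hνt n).2) hμ
      (hν.mono_right nhdsWithin_le_nhds) (hcμ.trans_le le_top).ne
      fun n => (not_lt.1 (hνt n).1).trans_lt htc) (not_le.2 hcμ)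

end LscTransport

/-! ### Convexity of the transport cost -/

section Convexity

variable {X Y : Type*} [MeasurableSpace X] [MeasurableSpace Y] {m : Measure X}

theorem integral_smul_add_smul {Z : Type*} [MeasurableSpace Z] {μ ν : Measure Z} {f : Z → ℝ}
    (hμ : Integrable f μ) (hν : Integrable f ν) (a b : ℝ≥0) :
    ∫ z, f z ∂(a • μ + b • ν) = a * ∫ z, f z ∂μ + b * ∫ z, f z ∂ν := by
  rw [integral_add_measure (hμ.smul_measure_nnreal) (hν.smul_measure_nnreal),
    integral_smul_nnreal_measure, integral_smul_nnreal_measure]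
  rfl

theorem convex_measuresWithFirstMarginal : Convex ℝ≥0 (measuresWithFirstMarginal Y m) := by
  intro μ hμ ν hν a b _ _ hab
  have h1 : (μ : Measure (X × Y)).map Prod.fst = m := hμ
  have h2 : (ν : Measure (X × Y)).map Prod.fst = m := hν
  change (a • (μ : Measure (X × Y)) + b • (ν : Measure (X × Y))).map Prod.fst = m
  rw [Measure.map_add _ _ measurable_fst, Measure.map_smul, Measure.map_smul, h1, h2, ← add_smul,
    hab, one_smul]

variable [TopologicalSpace X] [MetricSpace Y] [BorelSpace Y] [IsFiniteMeasure m]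
  [OpensMeasurableSpace (X × Y)]

theorem smul_add_smul_mem_plans {μ₁ μ₂ : FiniteMeasure (X × Y)}
    {Q₁ Q₂ : ProbabilityMeasure (L0 X Y m)} (h₁ : Q₁ ∈ plans μ₁) (h₂ : Q₂ ∈ plans μ₂) {a b : ℝ≥0}
    (hab : a + b = 1) :
    ∃ Q ∈ plans (m := m) (a • μ₁ + b • μ₂),
      (Q : Measure (L0 X Y m)) = a • (Q₁ : Measure (L0 X Y m)) + b • (Q₂ : Measure (L0 X Y m)) := by
  refine ⟨⟨a • (Q₁ : Measure (L0 X Y m)) + b • (Q₂ : Measure (L0 X Y m)), ⟨?_⟩⟩, fun φ => ?_, rfl⟩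
  · rw [Measure.add_apply, Measure.smul_apply, Measure.smul_apply, measure_univ, measure_univ,
      ← add_smul, hab, one_smul]
  · change ∫ z, φ z ∂(a • (μ₁ : Measure (X × Y)) + b • (μ₂ : Measure (X × Y))) =
      ∫ u, (∫ x, φ (x, u x) ∂m) ∂(a • (Q₁ : Measure (L0 X Y m)) + b • (Q₂ : Measure (L0 X Y m)))
    rw [integral_smul_add_smul (φ.integrable _) (φ.integrable _),
      integral_smul_add_smul (integrable_integral_graph Q₁ φ) (integrable_integral_graph Q₂ φ),
      h₁ φ, h₂ φ]

theorem convexOn_transportCost (E : L0 X Y m → ℝ≥0∞) :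
    ConvexOn ℝ≥0 (measuresWithFirstMarginal Y m) (transportCost E) := by
  refine ⟨convex_measuresWithFirstMarginal, fun μ₁ _ μ₂ _ a b _ _ hab => ?_⟩
  rcases eq_or_ne a 0 with rfl | ha
  · rw [zero_add] at hab
    simp [hab]
  rcases eq_or_ne b 0 with rfl | hb
  · rw [add_zero] at hab
    simp [hab]
  have ha' : (a : ℝ≥0∞) ≠ 0 := by simpa using ha
  have hb' : (b : ℝ≥0∞) ≠ 0 := by simpa using hb
  rw [ENNReal.smul_def, ENNReal.smul_def, smul_eq_mul, smul_eq_mul, transportCost, transportCost,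
    transportCost]
  simp only [ENNReal.mul_iInf_of_ne ha' ENNReal.coe_ne_top,
    ENNReal.mul_iInf_of_ne hb' ENNReal.coe_ne_top, ENNReal.iInf_add, ENNReal.add_iInf]
  refine le_iInf₂ fun Q₂ h₂ => ?_
  refine le_iInf₂ fun Q₁ h₁ => ?_
  obtain ⟨Q, hQ, hQeq⟩ := smul_add_smul_mem_plans h₁ h₂ hab
  refine (iInf₂_le Q hQ).trans_eq ?_
  rw [hQeq, lintegral_add_measure, lintegral_smul_measure, lintegral_smul_measure]
  rfl

end Convexity

/-! ### Duality for convex lower semicontinuous functionals -/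

section Duality

/-- A narrow neighbourhood is already determined by the integrals of finitely many bounded
continuous functions. -/
theorem exists_finset_integral_nhds {Z : Type*} [TopologicalSpace Z] [MeasurableSpace Z]
    [OpensMeasurableSpace Z] {μ : FiniteMeasure Z} {U : Set (FiniteMeasure Z)} (hU : U ∈ 𝓝 μ) :
    ∃ (I : Finset (Z →ᵇ ℝ)) (W : Set (I → ℝ)),
      W ∈ 𝓝 (fun φ : I => ∫ z, φ.1 z ∂(μ : Measure Z)) ∧
      ∀ ν : FiniteMeasure Z, (fun φ : I => ∫ z, φ.1 z ∂(ν : Measure Z)) ∈ W → ν ∈ U := by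
  let ι : FiniteMeasure Z → (Z →ᵇ ℝ) → ℝ := fun ν φ => ∫ z, φ z ∂(ν : Measure Z)
  have hle : comap ι (𝓝 (ι μ)) ≤ 𝓝 μ :=
    FiniteMeasure.tendsto_iff_forall_integral_tendsto.2 fun φ =>
      tendsto_pi_nhds.1 (tendsto_comap (f := ι) (x := 𝓝 (ι μ))) φ
  obtain ⟨V, hV, hVU⟩ := mem_comap.1 (hle hU)
  rw [nhds_pi, mem_pi'] at hV
  obtain ⟨I, t, ht, htV⟩ := hV
  refine ⟨I, Set.pi Set.univ fun φ => t φ.1, set_pi_mem_nhds Set.finite_univ fun φ _ => ht φ.1,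
    fun ν hν => hVU (htV fun φ hφ => hν ⟨φ, hφ⟩ trivial)⟩

variable {X Y : Type*} [TopologicalSpace X] [MeasurableSpace X] [TopologicalSpace Y]
  [MeasurableSpace Y] {m : Measure X} [OpensMeasurableSpace (X × Y)]

theorem integral_add_const_of_mem {ν : FiniteMeasure (X × Y)}
    (hν : ν ∈ measuresWithFirstMarginal Y m) (φ : (X × Y) →ᵇ ℝ) (c : ℝ) :
    ∫ z, (φ + BoundedContinuousFunction.const (X × Y) c) z ∂(ν : Measure (X × Y)) =
      ∫ z, φ z ∂(ν : Measure (X × Y)) + m.real Set.univ * c := by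
  simp only [BoundedContinuousFunction.coe_add, Pi.add_apply,
    BoundedContinuousFunction.const_apply]
  rw [integral_add (φ.integrable _) (integrable_const _), integral_const, smul_eq_mul,
    Measure.real, apply_univ_of_mem hν, Measure.real]

/-- The separation of the point `(μ, t)` from the epigraph of `H` by an affine function. When `b` is
positive, `(∫ φ dν + d) / b` is an affine minorant of `H` that exceeds `t` at `μ`; nothing is said
here about the sign of `b`. -/
theorem exists_separating {H : FiniteMeasure (X × Y) → ℝ≥0∞}
    (hH : ConvexOn ℝ≥0 (measuresWithFirstMarginal Y m) H)
    (hlsc : LowerSemicontinuousOn H (measuresWithFirstMarginal Y m))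
    {μ : FiniteMeasure (X × Y)} (hμ : μ ∈ measuresWithFirstMarginal Y m) {t : ℝ≥0}
    (ht : t < H μ) :
    ∃ (φ : (X × Y) →ᵇ ℝ) (b d : ℝ), b * t < ∫ z, φ z ∂(μ : Measure (X × Y)) + d ∧
      ∀ ν ∈ measuresWithFirstMarginal Y m, ∀ r : ℝ≥0, H ν ≤ r →
        ∫ z, φ z ∂(ν : Measure (X × Y)) + d < b * r := by
  classical
  obtain ⟨t', htt', ht'⟩ := ENNReal.lt_iff_exists_nnreal_btwn.1 ht
  obtain ⟨U, hU, hUs⟩ := mem_nhdsWithin_iff_exists_mem_nhds_inter.1 (hlsc μ hμ t' ht')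
  obtain ⟨I, W, hW, hWU⟩ := exists_finset_integral_nhds hU
  let ι : FiniteMeasure (X × Y) → I → ℝ := fun ν φ => ∫ z, φ.1 z ∂(ν : Measure (X × Y))
  -- The epigraph of `H`, seen through the integrals of the functions in `I`.
  let A : Set ((I → ℝ) × ℝ) :=
    {p | ∃ ν ∈ measuresWithFirstMarginal Y m, ∃ r : ℝ≥0, H ν ≤ r ∧ p = (ι ν, (r : ℝ))}
  have hA : Convex ℝ A := by
    rintro _ ⟨ν₁, h₁, r₁, hr₁, rfl⟩ _ ⟨ν₂, h₂, r₂, hr₂, rfl⟩ a b ha hb hab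
    lift a to ℝ≥0 using ha
    lift b to ℝ≥0 using hb
    have hab' : a + b = 1 := by exact_mod_cast hab
    refine ⟨a • ν₁ + b • ν₂, hH.1 h₁ h₂ zero_le zero_le hab', a * r₁ + b * r₂, ?_, ?_⟩
    · refine (hH.2 h₁ h₂ zero_le zero_le hab').trans ?_
      rw [ENNReal.smul_def, ENNReal.smul_def, smul_eq_mul, smul_eq_mul]
      push_cast
      gcongr
    · refine Prod.ext ?_ ?_
      · funext φ
        exact (integral_smul_add_smul (φ.1.integrable _) (φ.1.integrable _) a b).symm
      · simp
  have hnot : (ι μ, (t : ℝ)) ∉ closure A := fun hmem => by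
    have htt'' : (t : ℝ) < t' := by exact_mod_cast htt'
    obtain ⟨_, ⟨hw, hr⟩, ν, hν, r, hHr, rfl⟩ :=
      mem_closure_iff_nhds.1 hmem _ (prod_mem_nhds hW (Iio_mem_nhds htt''))
    have h1 : (t' : ℝ≥0∞) < H ν := hUs ⟨hWU ν hw, hν⟩
    have h2 : r < t' := hr
    exact absurd (h1.trans_le hHr) (not_lt.2 (by exact_mod_cast h2.le))
  obtain ⟨f, d, hfμ, hfA⟩ := geometric_hahn_banach_point_closed hA.closure isClosed_closure hnot
  let φ : (X × Y) →ᵇ ℝ := -∑ i : I, f (Pi.single i 1, 0) • i.1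
  have hf : ∀ (ν : FiniteMeasure (X × Y)) (r : ℝ),
      f (ι ν, r) = -∫ z, φ z ∂(ν : Measure (X × Y)) + f (0, 1) * r := fun ν r => by
    have h1 : ((ι ν, r) : (I → ℝ) × ℝ) =
        ∑ i : I, ι ν i • ((Pi.single i 1, 0) : (I → ℝ) × ℝ) + r • ((0, 1) : (I → ℝ) × ℝ) := by
      refine Prod.ext ?_ ?_
      · simp only [Prod.fst_add, Prod.fst_sum, Prod.smul_fst, smul_zero, add_zero]
        exact pi_eq_sum_univ' _
      · simp [Prod.snd_sum]
    have h2 : ∫ z, φ z ∂(ν : Measure (X × Y)) = -∑ i : I, f (Pi.single i 1, 0) * ι ν i := by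
      simp only [φ, BoundedContinuousFunction.coe_neg, Pi.neg_apply,
        BoundedContinuousFunction.coe_sum, Finset.sum_apply, BoundedContinuousFunction.coe_smul,
        smul_eq_mul, integral_neg]
      rw [integral_finsetSum _ fun i _ => (i.1.integrable _).const_mul _]
      simp only [integral_const_mul, ι]
    rw [h1, map_add, map_sum, h2, neg_neg]
    simp only [map_smul, smul_eq_mul, mul_comm]
  rw [hf] at hfμ
  refine ⟨φ, f (0, 1), d, by linarith, fun ν hν r hr => ?_⟩
  have h := hfA _ (subset_closure ⟨ν, hν, r, hr, rfl⟩)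
  rw [hf] at h
  linarith

variable [IsFiniteMeasure m]

/-- Fenchel–Moreau duality: a convex lower semicontinuous functional with values in `[0, ∞]` is
the supremum of its continuous linear minorants. No additive constants are needed because they can
be absorbed into `φ` when all measures have the same nonzero mass. -/
theorem exists_minorant (hm : m ≠ 0) {H : FiniteMeasure (X × Y) → ℝ≥0∞}
    (hH : ConvexOn ℝ≥0 (measuresWithFirstMarginal Y m) H)
    (hlsc : LowerSemicontinuousOn H (measuresWithFirstMarginal Y m))
    {μ : FiniteMeasure (X × Y)} (hμ : μ ∈ measuresWithFirstMarginal Y m) {t : ℝ≥0}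
    (ht : t < H μ) :
    ∃ φ : (X × Y) →ᵇ ℝ, t < ∫ z, φ z ∂(μ : Measure (X × Y)) ∧
      ∀ ν ∈ measuresWithFirstMarginal Y m,
        ENNReal.ofReal (∫ z, φ z ∂(ν : Measure (X × Y))) ≤ H ν := by
  suffices h : ∃ φ : (X × Y) →ᵇ ℝ, t < ∫ z, φ z ∂(μ : Measure (X × Y)) ∧
      ∀ ν ∈ measuresWithFirstMarginal Y m, ∀ r : ℝ≥0, H ν ≤ r →
        ∫ z, φ z ∂(ν : Measure (X × Y)) ≤ r by
    obtain ⟨φ, hφμ, hφ⟩ := h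
    refine ⟨φ, hφμ, fun ν hν => ?_⟩
    rcases eq_or_ne (H ν) ∞ with h | h
    · rw [h]
      exact le_top
    · rw [← ENNReal.coe_toNNReal h, ENNReal.ofReal_le_coe]
      exact hφ ν hν _ (ENNReal.coe_toNNReal h).ge
  have hM : 0 < m.real Set.univ :=
    ENNReal.toReal_pos (Measure.measure_univ_ne_zero.2 hm) (measure_ne_top _ _)
  obtain ⟨φ, b, d, hφμ, hφ⟩ := exists_separating hH hlsc hμ ht
  -- Absorb the constant `d` into `φ`.
  obtain ⟨φ, hφμ, hφ⟩ : ∃ φ : (X × Y) →ᵇ ℝ, b * t < ∫ z, φ z ∂(μ : Measure (X × Y)) ∧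
      ∀ ν ∈ measuresWithFirstMarginal Y m, ∀ r : ℝ≥0, H ν ≤ r →
        ∫ z, φ z ∂(ν : Measure (X × Y)) < b * r := by
    have hd : ∀ ν ∈ measuresWithFirstMarginal Y m,
        ∫ z, (φ + BoundedContinuousFunction.const (X × Y) (d / m.real Set.univ)) z
          ∂(ν : Measure (X × Y)) = ∫ z, φ z ∂(ν : Measure (X × Y)) + d := fun ν hν => by
      rw [integral_add_const_of_mem hν, mul_div_cancel₀ d hM.ne']
    refine ⟨φ + BoundedContinuousFunction.const (X × Y) (d / m.real Set.univ), ?_,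
      fun ν hν r hr => ?_⟩
    · rw [hd μ hμ]
      exact hφμ
    · rw [hd ν hν]
      exact hφ ν hν r hr
  have hsmul : ∀ (c : ℝ) (ν : FiniteMeasure (X × Y)),
      ∫ z, (c • φ) z ∂(ν : Measure (X × Y)) = c * ∫ z, φ z ∂(ν : Measure (X × Y)) := fun c ν => by
    simp only [BoundedContinuousFunction.coe_smul, smul_eq_mul, integral_const_mul]
  rcases lt_trichotomy b 0 with hb | hb | hb
  · -- A negative `b` contradicts the separation for large `r`, unless `H = ∞` everywhere.
    have htop : ∀ ν ∈ measuresWithFirstMarginal Y m, ∀ r : ℝ≥0, ¬ H ν ≤ r := by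
      intro ν hν r hr
      obtain ⟨n, hn⟩ := exists_nat_gt ((∫ z, φ z ∂(ν : Measure (X × Y))) / b)
      have h1 := hφ ν hν (max r n) (hr.trans (by exact_mod_cast le_max_left _ _))
      rw [div_lt_iff_of_neg hb] at hn
      have h2 : b * (max r n : ℝ≥0) ≤ b * n :=
        mul_le_mul_of_nonpos_left (by exact_mod_cast le_max_right r n) hb.le
      linarith
    refine ⟨BoundedContinuousFunction.const (X × Y) ((t + 1) / m.real Set.univ), ?_,
      fun ν hν r hr => (htop ν hν r hr).elim⟩
    have := integral_add_const_of_mem hμ 0 ((t + 1) / m.real Set.univ)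
    rw [zero_add, mul_div_cancel₀ _ hM.ne'] at this
    rw [this]
    simp
  · -- With `b = 0`, all multiples of `φ` are admissible.
    subst hb
    simp only [zero_mul] at hφμ hφ
    obtain ⟨n, hn⟩ := exists_nat_gt ((t : ℝ) / ∫ z, φ z ∂(μ : Measure (X × Y)))
    rw [div_lt_iff₀ hφμ] at hn
    refine ⟨(n : ℝ) • φ, by rwa [hsmul], fun ν hν r hr => ?_⟩
    rw [hsmul]
    exact (mul_nonpos_of_nonneg_of_nonpos n.cast_nonneg (hφ ν hν r hr).le).trans r.2
  · refine ⟨b⁻¹ • φ, ?_, fun ν hν r hr => ?_⟩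
    · rw [hsmul, lt_inv_mul_iff₀ hb]
      exact hφμ
    · rw [hsmul, inv_mul_le_iff₀ hb]
      exact (hφ ν hν r hr).le

end Duality

/-! ### The envelope property and the dual formula -/

section Envelope

theorem coe_le_coe_ennreal_iff {x : ℝ} {e : ℝ≥0∞} :
    (x : EReal) ≤ (e : EReal) ↔ ENNReal.ofReal x ≤ e := by
  refine ⟨fun h => ?_, fun h => ?_⟩
  · simpa using EReal.toENNReal_le_toENNReal h
  · refine le_trans ?_ (EReal.coe_ennreal_le_coe_ennreal_iff.2 h)
    rw [EReal.coe_ennreal_ofReal]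
    exact EReal.coe_le_coe_iff.2 (le_max_left x 0)

theorem mem_dualAdmissible_iff {X Y : Type*} [TopologicalSpace X] [MeasurableSpace X]
    [MetricSpace Y] {m : Measure X} {E : L0 X Y m → ℝ≥0∞} {φ : (X × Y) →ᵇ ℝ} :
    φ ∈ dualAdmissible E ↔ ∀ u : L0 X Y m, ENNReal.ofReal (∫ x, φ (x, u x) ∂m) ≤ E u :=
  forall_congr' fun _ => coe_le_coe_ennreal_iff

variable {X Y : Type*} [TopologicalSpace X] [MeasurableSpace X] [MetricSpace Y]
  [MeasurableSpace Y] [BorelSpace Y] {m : Measure X} [IsFiniteMeasure m]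
  [OpensMeasurableSpace (X × Y)]

/-- Integrating a continuous linear minorant of `E` against a plan. -/
theorem ofReal_integral_le_lintegral_of_mem_plans {E : L0 X Y m → ℝ≥0∞} {φ : (X × Y) →ᵇ ℝ}
    (hφ : ∀ u : L0 X Y m, ENNReal.ofReal (∫ x, φ (x, u x) ∂m) ≤ E u)
    {μ : FiniteMeasure (X × Y)} {Q : ProbabilityMeasure (L0 X Y m)} (hQ : Q ∈ plans μ) :
    ENNReal.ofReal (∫ z, φ z ∂(μ : Measure (X × Y))) ≤
      ∫⁻ u, E u ∂(Q : Measure (L0 X Y m)) := by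
  rw [hQ φ]
  refine (ENNReal.ofReal_le_ofReal (integral_mono (integrable_integral_graph Q φ)
    (integrable_integral_graph Q φ).pos_part fun u => le_max_left _ _)).trans ?_
  rw [ofReal_integral_eq_lintegral_ofReal (integrable_integral_graph Q φ).pos_part
    (Eventually.of_forall fun u => le_max_right _ _)]
  refine lintegral_mono fun u => ?_
  rw [ENNReal.ofReal_max, ENNReal.ofReal_zero, max_eq_left zero_le]
  exact hφ u

theorem transportCost_eq_iSup (hm : m ≠ 0) {E : L0 X Y m → ℝ≥0∞}
    (hlsc : LowerSemicontinuousOn (transportCost E) (measuresWithFirstMarginal Y m))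
    (hgraph : ∀ u : L0 X Y m, transportCost E (graphMeasure u) ≤ E u)
    {μ : FiniteMeasure (X × Y)} (hμ : μ ∈ measuresWithFirstMarginal Y m) :
    (transportCost E μ : EReal) =
      ⨆ φ ∈ dualAdmissible E, ((∫ z, φ z ∂(μ : Measure (X × Y)) : ℝ) : EReal) := by
  refine le_antisymm ?_ (iSup₂_le fun φ hφ => ?_)
  · by_contra! h
    set S : EReal := ⨆ φ ∈ dualAdmissible E, ((∫ z, φ z ∂(μ : Measure (X × Y)) : ℝ) : EReal)
    have hS0 : 0 ≤ S := by
      refine le_trans ?_ (le_iSup₂ (f := fun (φ : (X × Y) →ᵇ ℝ) (_ : φ ∈ dualAdmissible E) =>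
        ((∫ z, φ z ∂(μ : Measure (X × Y)) : ℝ) : EReal)) 0
          (mem_dualAdmissible_iff.2 fun u => by simp))
      simp
    have hSt : S.toENNReal < transportCost E μ := by
      rwa [← EReal.coe_ennreal_lt_coe_ennreal_iff, EReal.coe_toENNReal hS0]
    obtain ⟨t, ht⟩ := WithTop.ne_top_iff_exists.1 (hSt.trans_le le_top).ne
    change (t : ℝ≥0∞) = _ at ht
    rw [← ht] at hSt
    obtain ⟨φ, hφμ, hφ⟩ := exists_minorant hm (convexOn_transportCost E) hlsc hμ hSt
    have hφS : ((∫ z, φ z ∂(μ : Measure (X × Y)) : ℝ) : EReal) ≤ S :=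
      le_iSup₂ (f := fun (φ : (X × Y) →ᵇ ℝ) (_ : φ ∈ dualAdmissible E) =>
        ((∫ z, φ z ∂(μ : Measure (X × Y)) : ℝ) : EReal)) φ (mem_dualAdmissible_iff.2 fun u => by
          rw [← integral_graphMeasure]
          exact (hφ _ (graphMeasure_mem u)).trans (hgraph u))
    rw [← EReal.coe_toENNReal hS0, ← ht, coe_le_coe_ennreal_iff, ENNReal.ofReal_le_coe] at hφS
    exact absurd hφS (not_le.2 hφμ)
  · refine coe_le_coe_ennreal_iff.2 (le_iInf₂ fun Q hQ => ?_)
    exact ofReal_integral_le_lintegral_of_mem_plans (mem_dualAdmissible_iff.1 hφ) hQ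

/-- Every convex lower semicontinuous functional below the cost of graph measures is below
`transportCost E`: this is Jensen's inequality, obtained by integrating the continuous linear
minorants of the functional against a plan. -/
theorem le_transportCost_of_convexOn {E : L0 X Y m → ℝ≥0∞} {H : FiniteMeasure (X × Y) → ℝ≥0∞}
    (hH : ConvexOn ℝ≥0 (measuresWithFirstMarginal Y m) H)
    (hlsc : LowerSemicontinuousOn H (measuresWithFirstMarginal Y m))
    (hle : ∀ u : L0 X Y m, H (graphMeasure u) ≤ E u)
    {μ : FiniteMeasure (X × Y)} (hμ : μ ∈ measuresWithFirstMarginal Y m) :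
    H μ ≤ transportCost E μ := by
  refine le_iInf₂ fun Q hQ => ?_
  rcases eq_or_ne m 0 with hm | hm
  · -- All graph measures are then equal to `μ = 0`.
    have h0 : ∀ u : L0 X Y m, graphMeasure u = μ := fun u => by
      refine FiniteMeasure.toMeasure_injective ?_
      have h : ∀ ν ∈ measuresWithFirstMarginal Y m, (ν : Measure (X × Y)) = 0 := fun ν hν =>
        Measure.measure_univ_eq_zero.1 ((apply_univ_of_mem hν).trans (by simp [hm]))
      rw [h _ (graphMeasure_mem u), h μ hμ]
    calc H μ = ∫⁻ _ : L0 X Y m, H μ ∂(Q : Measure (L0 X Y m)) := by simp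
      _ ≤ ∫⁻ u, E u ∂(Q : Measure (L0 X Y m)) := lintegral_mono fun u => h0 u ▸ hle u
  · refine ENNReal.le_of_forall_nnreal_lt fun t ht => ?_
    obtain ⟨φ, hφμ, hφ⟩ := exists_minorant hm hH hlsc hμ ht
    refine le_trans ?_ (ofReal_integral_le_lintegral_of_mem_plans (φ := φ) (fun u => ?_) hQ)
    · rw [← ENNReal.ofReal_coe_nnreal]
      exact ENNReal.ofReal_le_ofReal hφμ.le
    · rw [← integral_graphMeasure]
      exact (hφ _ (graphMeasure_mem u)).trans (hle u)

end Envelope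

end MultimarginalOT

theorem mainTheorem2 {X Y : Type*}
    [TopologicalSpace X] [PolishSpace X] [MeasurableSpace X] [BorelSpace X]
    [MetricSpace Y] [CompleteSpace Y] [SecondCountableTopology Y]
    [MeasurableSpace Y] [BorelSpace Y]
    (m : Measure X) [IsFiniteMeasure m]
    (E : MultimarginalOT.L0 X Y m → ℝ≥0∞) (hE : MultimarginalOT.IsLscCoercive E) :
    MultimarginalOT.IsConvexLscEnvelopeOn (MultimarginalOT.measuresWithFirstMarginal Y m)
        (MultimarginalOT.diracLift E) (MultimarginalOT.transportCost E) ∧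
      (∀ u : MultimarginalOT.L0 X Y m,
        MultimarginalOT.transportCost E (MultimarginalOT.graphMeasure u) =
            MultimarginalOT.diracLift E (MultimarginalOT.graphMeasure u) ∧
          MultimarginalOT.diracLift E (MultimarginalOT.graphMeasure u) = E u) ∧
      (m ≠ 0 → ∀ μ ∈ MultimarginalOT.measuresWithFirstMarginal Y m,
        (MultimarginalOT.transportCost E μ : EReal) =
          ⨆ φ ∈ MultimarginalOT.dualAdmissible E,
            ((∫ z, φ z ∂(μ : Measure (X × Y)) : ℝ) : EReal)) := by
  open MultimarginalOT in
  have hlsc := lowerSemicontinuousOn_transportCost hE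
  refine ⟨⟨⟨convexOn_transportCost E, hlsc, fun μ _ => transportCost_le_diracLift E μ⟩,
    fun H hH hHlsc hHle μ hμ => le_transportCost_of_convexOn hH hHlsc (fun u => ?_) hμ⟩,
    fun u => ⟨?_, diracLift_graphMeasure E u⟩,
    fun hm μ hμ => transportCost_eq_iSup hm hlsc (fun u => (transportCost_graphMeasure E u).le) hμ⟩
  · exact (hHle _ (graphMeasure_mem u)).trans_eq (diracLift_graphMeasure E u)
  · rw [transportCost_graphMeasure, diracLift_graphMeasure]
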